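/- **Setting.** An *effect algebra* is a partial algebra $E=(E;+,0,1)$ with a partially defined binary operation $+$ and constants $0,1$ such that, for all $a,b,c\in E$: (i) $a+b$ is defined iff $b+a$ is, and then $a+b=b+a$; (ii) $a+b$ and $(a+b)+c$ are defined iff $b+c$ and $a+(b+c)$ are defined, and then $(a+b)+c=a+(b+c)$; (iii) there is a unique $a'\in E$ with $a+a'=1$; (iv) if $a+1$ is defined, then $a=0$. It is partially ordered by $a\le b$ iff $a+c=b$ for some $c\in E$. A *$\sigma$-MV-effect algebra* is an effect algebra that is a lattice in which $a\wedge b=0$ implies that $a+b$ is defined, and in which every nonempty countable set has a supremum and an infimum. An *observable* on $E$ is a map $x:\mathcal B(\mathbb R)\to E$ on the Borel $\sigma$-algebra of $\mathbb R$ such that $x(\mathbb R)=1$; $x(A)+x(B)$ is defined and equals $x(A\cup B)$ whenever $A\cap B=\emptyset$; and $x(\bigcup_i A_i)=\bigvee_i x(A_i)$ whenever $A_1\subseteq A_2\subseteq\cdots$. It is *bounded* if $x([\alpha,\beta])=1$ for some real $\alpha\le\beta$. Put $B_x(t):=x((-\infty,t))$ for $t\in\mathbb R$. **Theorem.** Let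 $x$ and $y$ be bounded observables on a $\sigma$-MV-effect algebra $E$, and define $$B_{x+y}(t):=\bigvee_{r\in\mathbb Q}\bigl(B_x(r)\wedge B_y(t-r)\bigr),\qquad t\in\mathbb R.$$ Then $\{B_{x+y}(t):t\in\mathbb R\}$ satisfies $$B_{x+y}(t)\le B_{x+y}(s)\quad\text{if } t<s,$$ $$\bigwedge_{t\in\mathbb R}B_{x+y}(t)=0,\qquad \bigvee_{t\in\mathbb R}B_{x+y}(t)=1,$$ $$\bigvee_{t<s}B_{x+y}(t)=B_{x+y}(s),\qquad s\in\mathbb R$$ (all these suprema and infima existing in $E$), and there is a unique bounded observable $z$ on $E$ such that $B_{x+y}(t)=B_z(t)$ for every $t\in\mathbb R$. In addition, $B_{x+y}(t)=B_{y+x}(t)$ for every $t\in\mathbb R$, where $B_{y+x}$ is defined by the same formula with $x$ and $y$ interchanged. -/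

import Mathlib

/-- An effect algebra: a partial algebra `(E; +, 0, 1)`. The partial operation is
`padd : E → E → Option E`; `padd a b = some c` says that `a + b` is defined and equal to `c`,
`padd a b = none` says that `a + b` is not defined. -/
class EffectAlgebra (E : Type*) extends Zero E, One E where
  padd : E → E → Option E
  /-- `a + b` is defined iff `b + a` is, and then they are equal. -/
  padd_comm : ∀ a b : E, padd a b = padd b a
  /-- `a + b` and `(a + b) + c` are defined iff `b + c` and `a + (b + c)` are, and then
  `(a + b) + c = a + (b + c)`. -/
  padd_assoc : ∀ a b c : E,
    (padd a b).bind (fun s => padd s c) = (padd b c).bind (fun s => padd a s)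
  /-- Every element has a unique orthosupplement. -/
  exists_unique_compl : ∀ a : E, ∃! a' : E, padd a a' = some 1
  /-- If `a + 1` is defined, then `a = 0`. -/
  eq_zero_of_padd_one : ∀ a : E, (padd a 1).isSome → a = 0

namespace EffectAlgebra

section Order

variable {E : Type*} [EffectAlgebra E]

theorem padd_assoc_left {a b c s u : E} (h : padd a b = some s) (h' : padd s c = some u) :
    ∃ v, padd b c = some v ∧ padd a v = some u := by
  have := padd_assoc a b c
  rw [h, Option.bind_some, h'] at this
  exact Option.bind_eq_some_iff.mp this.symm

theorem padd_assoc_right {a b c v u : E} (h : padd b c = some v) (h' : padd a v = some u) :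
    ∃ s, padd a b = some s ∧ padd s c = some u := by
  have := padd_assoc a b c
  rw [h, Option.bind_some, h'] at this
  exact Option.bind_eq_some_iff.mp this

theorem one_padd_zero : padd (1 : E) 0 = some 1 := by
  obtain ⟨z, hz, -⟩ := exists_unique_compl (1 : E)
  have : z = 0 := eq_zero_of_padd_one z (by rw [padd_comm]; simp [hz])
  rwa [this] at hz

theorem padd_zero (a : E) : padd a 0 = some a := by
  obtain ⟨b, hb, -⟩ := exists_unique_compl a
  rw [padd_comm] at hb
  obtain ⟨v, hv, hbv⟩ := padd_assoc_left hb one_padd_zero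
  obtain ⟨c, -, hc⟩ := exists_unique_compl b
  rw [hv, hc v hbv, hc a hb]

theorem padd_left_cancel {a b c s : E} (hb : padd a b = some s) (hc : padd a c = some s) :
    b = c := by
  obtain ⟨d, hd, -⟩ := exists_unique_compl s
  rw [padd_comm] at hb hc
  obtain ⟨v, hv, hbv⟩ := padd_assoc_left hb hd
  obtain ⟨w, hw, hcw⟩ := padd_assoc_left hc hd
  have hvw : v = w := Option.some_injective _ (hv.symm.trans hw)
  subst hvw
  rw [padd_comm] at hbv hcw
  exact (exists_unique_compl v).unique hbv hcw

theorem eq_zero_of_padd_eq_zero {a b : E} (h : padd a b = some 0) : a = 0 := by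
  have h1 : padd (0 : E) 1 = some 1 := by rw [padd_comm]; exact one_padd_zero
  rw [padd_comm] at h
  obtain ⟨v, hv, -⟩ := padd_assoc_left h h1
  exact eq_zero_of_padd_one a (by simp [hv])

/-- The order of an effect algebra: `a ≤ b` iff `a + c = b` for some `c`. -/
instance instPartialOrder : PartialOrder E where
  le a b := ∃ c, padd a c = some b
  le_refl a := ⟨0, padd_zero a⟩
  le_trans a b c := by
    rintro ⟨d, hd⟩ ⟨e, he⟩
    obtain ⟨v, -, hv⟩ := padd_assoc_left hd he
    exact ⟨v, hv⟩
  le_antisymm a b := by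
    rintro ⟨c, hc⟩ ⟨d, hd⟩
    obtain ⟨v, hv, hav⟩ := padd_assoc_left hc hd
    have hv0 : v = 0 := padd_left_cancel hav (padd_zero a)
    subst hv0
    have hc0 : c = 0 := eq_zero_of_padd_eq_zero hv
    subst hc0
    exact Option.some_injective _ ((padd_zero a).symm.trans hc)

theorem le_iff {a b : E} : a ≤ b ↔ ∃ c, padd a c = some b := Iff.rfl

end Order

end EffectAlgebra

/-- A lattice effect algebra: every two elements have a supremum and an infimum. -/
class LatticeEffectAlgebra (E : Type*) [EffectAlgebra E] : Prop where
  exists_isLUB_pair : ∀ a b : E, ∃ s, IsLUB {a, b} s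
  exists_isGLB_pair : ∀ a b : E, ∃ s, IsGLB {a, b} s

/-- The lattice operations of a lattice effect algebra (determined by its order). -/
noncomputable instance LatticeEffectAlgebra.instLattice {E : Type*} [EffectAlgebra E]
    [LatticeEffectAlgebra E] : Lattice E where
  __ := EffectAlgebra.instPartialOrder
  sup a b := (LatticeEffectAlgebra.exists_isLUB_pair a b).choose
  inf a b := (LatticeEffectAlgebra.exists_isGLB_pair a b).choose
  le_sup_left a b := (LatticeEffectAlgebra.exists_isLUB_pair a b).choose_spec.1 (by simp)
  le_sup_right a b := (LatticeEffectAlgebra.exists_isLUB_pair a b).choose_spec.1 (by simp)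
  sup_le a b _ ha hb := (LatticeEffectAlgebra.exists_isLUB_pair a b).choose_spec.2
    (by rintro x (rfl | rfl) <;> assumption)
  inf_le_left a b := (LatticeEffectAlgebra.exists_isGLB_pair a b).choose_spec.1 (by simp)
  inf_le_right a b := (LatticeEffectAlgebra.exists_isGLB_pair a b).choose_spec.1 (by simp)
  le_inf _ a b ha hb := (LatticeEffectAlgebra.exists_isGLB_pair a b).choose_spec.2
    (by rintro x (rfl | rfl) <;> assumption)

/-- An MV-effect algebra: a lattice effect algebra in which `a ∧ b = 0` implies that `a + b`
is defined. -/
class MVEffectAlgebra (E : Type*) [EffectAlgebra E] : Prop extends LatticeEffectAlgebra E where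
  isSome_padd_of_inf_eq_zero : ∀ a b : E, a ⊓ b = 0 → (EffectAlgebra.padd a b).isSome

/-- A σ-MV-effect algebra: an MV-effect algebra that is a σ-lattice, i.e. every nonempty
countable set has a supremum and an infimum. -/
class SigmaMVEffectAlgebra (E : Type*) [EffectAlgebra E] : Prop extends MVEffectAlgebra E where
  exists_isLUB_of_countable : ∀ S : Set E, S.Countable → S.Nonempty → ∃ s, IsLUB S s
  exists_isGLB_of_countable : ∀ S : Set E, S.Countable → S.Nonempty → ∃ s, IsGLB S s

namespace SigmaMVEffectAlgebra

/-- The supremum `⋁ i, f i` of a nonempty countable family in a σ-MV-effect algebra. -/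
noncomputable def countableSup {E : Type*} [EffectAlgebra E] [SigmaMVEffectAlgebra E]
    {ι : Type*} [Countable ι] [Nonempty ι] (f : ι → E) : E :=
  (exists_isLUB_of_countable (Set.range f) (Set.countable_range f) (Set.range_nonempty f)).choose

theorem isLUB_countableSup {E : Type*} [EffectAlgebra E] [SigmaMVEffectAlgebra E]
    {ι : Type*} [Countable ι] [Nonempty ι] (f : ι → E) :
    IsLUB (Set.range f) (countableSup f) :=
  (exists_isLUB_of_countable (Set.range f) (Set.countable_range f)
    (Set.range_nonempty f)).choose_spec

end SigmaMVEffectAlgebra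

/-- The Borel σ-algebra of the real line, as a type. -/
abbrev BorelSet : Type := {A : Set ℝ // MeasurableSet A}

/-- An observable on `E`: a map `x : 𝓑(ℝ) → E` with `x(ℝ) = 1` that is finitely additive
(the sum `x(A) + x(B)` being defined for disjoint `A`, `B`) and continuous along increasing
sequences. -/
@[ext]
structure Observable (E : Type*) [EffectAlgebra E] where
  toFun : BorelSet → E
  map_univ : toFun ⟨Set.univ, MeasurableSet.univ⟩ = 1
  map_union : ∀ A B : BorelSet, Disjoint A.1 B.1 →
    EffectAlgebra.padd (toFun A) (toFun B) = some (toFun ⟨A.1 ∪ B.1, A.2.union B.2⟩)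
  map_iUnion : ∀ A : ℕ → BorelSet, (∀ i, (A i).1 ⊆ (A (i + 1)).1) →
    IsLUB (Set.range fun i => toFun (A i))
      (toFun ⟨⋃ i, (A i).1, MeasurableSet.iUnion fun i => (A i).2⟩)

namespace Observable

variable {E : Type*} [EffectAlgebra E]

/-- `x` is bounded if `x([α, β]) = 1` for some interval `[α, β]`. -/
def IsBounded (x : Observable E) : Prop :=
  ∃ α β : ℝ, α ≤ β ∧ x.toFun ⟨Set.Icc α β, measurableSet_Icc⟩ = 1

/-- The spectral resolution `B_x(t) = x((-∞, t))` of an observable. -/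
def resolution (x : Observable E) (t : ℝ) : E :=
  x.toFun ⟨Set.Iio t, measurableSet_Iio⟩

/-- `B_{x+y}(t) = ⋁_{r ∈ ℚ} (B_x(r) ∧ B_y(t - r))`. -/
noncomputable def sumResolution [SigmaMVEffectAlgebra E] (x y : Observable E) (t : ℝ) : E :=
  SigmaMVEffectAlgebra.countableSup fun r : ℚ => x.resolution (r : ℝ) ⊓ y.resolution (t - r)

end Observable

/-- A family `(B(t))_{t ∈ ℝ}` is monotone, has infimum `0` and supremum `1`, and is continuous
from the left, all these suprema and infima existing in `E`. -/
structure IsSpectralResolution {E : Type*} [EffectAlgebra E] (B : ℝ → E) : Prop where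
  mono : ∀ t s : ℝ, t < s → B t ≤ B s
  isGLB_zero : IsGLB (Set.range B) 0
  isLUB_one : IsLUB (Set.range B) 1
  left_cont : ∀ s : ℝ, IsLUB (B '' Set.Iio s) (B s)

/-! An MV-effect algebra that is σ-complete behaves like an algebra of `[0,1]`-valued functions
modulo meagre sets (a Loomis–Sikorski representation), and in such functions the claims reduce to
real analysis.

The points are the states `φ : E → ℝ` that preserve binary meets. They come from prime ideals `P`:
in the chain `E / P` an element is assigned a real number through its binary expansion (`approx`),
the error in additivity halves at each step (`IsPrimeIdeal.approx_add`), and an ultrafilter limit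
gives `IsPrimeIdeal.exists_isPoint`. σ-completeness makes `E` Archimedean, so points detect nonzero
elements (`exists_isPoint_pos`), and therefore the order.

The points form a compact Hausdorff, hence Baire, space. A given countable supremum is computed
pointwise off a meagre set (`eventually_isLUB`), and an inequality valid off a meagre set holds in
`E` (`le_of_eventually_point`).

For a spectral resolution `B` with bounded support, each point `φ` yields a Stieltjes probability
measure `μ φ` from `t ↦ φ (B t)`. The Borel sets `A` for which some `a : E` satisfies `μ φ A = φ a`
for almost every `φ` contain all rays and form a Dynkin class, so every Borel set qualifies. The
element `a` is unique, and `A ↦ a` is the required observable. Its uniqueness is a π-λ argument. The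
properties of the sum resolution follow from left continuity and from meets distributing over the
supremum defining `B_y(s)`. -/

/-- Formal values of sums in an effect algebra, `none` standing for an undefined sum. -/
def PartialSum (E : Type*) := Option E

/-! ### Calculus of partial sums and differences -/

namespace EffectAlgebra

/-- An element seen as the value of a sum. -/
def of {E : Type*} (a : E) : PartialSum E := some a

theorem of_injective {E : Type*} : Function.Injective (of : E → PartialSum E) :=
  Option.some_injective E

section Basic

variable {E : Type*} [EffectAlgebra E]

theorem zero_padd (a : E) : padd 0 a = some a := by rw [padd_comm]; exact padd_zero a

instance : Add (PartialSum E) :=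
  ⟨fun x y => Option.bind x fun a => Option.bind y fun b => padd a b⟩

instance : Zero (PartialSum E) := ⟨of 0⟩

instance : AddCommMonoid (PartialSum E) where
  nsmul := nsmulRec
  add_assoc x y z := by
    rcases x with _ | a
    · rfl
    rcases y with _ | b
    · rfl
    rcases z with _ | c
    · change Option.bind (padd a b) (fun _ => none) = none
      cases padd a b <;> rfl
    · exact padd_assoc a b c
  zero_add x := by
    rcases x with _ | a
    · rfl
    · exact zero_padd a
  add_zero x := by
    rcases x with _ | a
    · rfl
    · exact padd_zero a
  add_comm x y := by
    rcases x with _ | a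
    · rcases y with _ | b <;> rfl
    rcases y with _ | b
    · rfl
    · exact padd_comm a b

theorem of_add_of (a b : E) : of a + of b = padd a b := rfl

theorem of_zero : of (0 : E) = 0 := rfl

theorem exists_left_of_add_eq {x y : PartialSum E} {c : E} (h : x + y = of c) :
    ∃ a, x = of a := by
  rcases x with _ | a
  · cases h
  · exact ⟨a, rfl⟩

theorem exists_right_of_add_eq {x y : PartialSum E} {c : E} (h : x + y = of c) :
    ∃ a, y = of a :=
  exists_left_of_add_eq ((add_comm y x).trans h)

theorem of_add_cancel {a c : E} {x y : PartialSum E} (hx : of a + x = of c)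
    (hy : of a + y = of c) : x = y := by
  obtain ⟨b, rfl⟩ := exists_right_of_add_eq hx
  obtain ⟨d, rfl⟩ := exists_right_of_add_eq hy
  exact congrArg of (padd_left_cancel hx hy)

theorem of_add_cancel_add {c : E} {x y z : PartialSum E} (hy : x + y = of c)
    (hz : x + z = of c) : y = z := by
  obtain ⟨a, rfl⟩ := exists_left_of_add_eq hy
  exact of_add_cancel hy hz

theorem le_iff_of {a b : E} : a ≤ b ↔ ∃ c, of a + of c = of b := Iff.rfl

theorem le_of_add {a c : E} {x : PartialSum E} (h : of a + x = of c) : a ≤ c := by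
  obtain ⟨b, rfl⟩ := exists_right_of_add_eq h
  exact ⟨b, h⟩

theorem zero_le' (a : E) : 0 ≤ a := ⟨a, zero_padd a⟩

theorem le_zero_iff' {a : E} : a ≤ 0 ↔ a = 0 :=
  ⟨fun h => le_antisymm h (zero_le' a), fun h => h.le⟩

noncomputable instance : Compl E := ⟨fun a => (exists_unique_compl a).choose⟩

theorem add_compl (a : E) : of a + of aᶜ = of 1 := (exists_unique_compl a).choose_spec.1

theorem eq_compl_of_add {a b : E} (h : of a + of b = of 1) : b = aᶜ :=
  of_injective (of_add_cancel h (add_compl a))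

theorem compl_compl' (a : E) : aᶜᶜ = a :=
  (eq_compl_of_add ((add_comm _ _).trans (add_compl a))).symm

theorem compl_zero' : (0 : E)ᶜ = 1 :=
  (eq_compl_of_add (by rw [of_zero, zero_add])).symm

theorem compl_one' : (1 : E)ᶜ = 0 := by rw [← compl_zero', compl_compl']

theorem le_one' (a : E) : a ≤ 1 := ⟨aᶜ, add_compl a⟩

theorem compl_add_of_add {a b c : E} (h : of a + of b = of c) : of cᶜ + of b = of aᶜ := by
  have h1 := add_compl c
  rw [← h, add_assoc] at h1
  rw [add_comm, of_add_cancel h1 (add_compl a)]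

theorem compl_le_compl' {a b : E} (h : a ≤ b) : bᶜ ≤ aᶜ := by
  obtain ⟨c, hc⟩ := le_iff_of.1 h
  exact ⟨c, compl_add_of_add hc⟩

theorem le_compl_iff {a b : E} : a ≤ bᶜ ↔ ∃ c, of a + of b = of c := by
  constructor
  · intro h
    obtain ⟨c, hc⟩ := le_iff_of.1 h
    have h1 := add_compl b
    rw [← hc, add_left_comm, ← add_assoc] at h1
    obtain ⟨d, hd⟩ := exists_left_of_add_eq h1
    exact ⟨d, hd⟩
  · rintro ⟨c, hc⟩
    rw [add_comm] at hc
    have := compl_add_of_add hc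
    rw [add_comm] at this
    exact ⟨_, this⟩

/-- Sums in an effect algebra are monotone. -/
theorem exists_add_le {a a' b b' c : E} (ha : a' ≤ a) (hb : b' ≤ b) (h : of a + of b = of c) :
    ∃ c', of a' + of b' = of c' ∧ c' ≤ c := by
  obtain ⟨u, hu⟩ := le_iff_of.1 ha
  obtain ⟨v, hv⟩ := le_iff_of.1 hb
  have h1 : (of a' + of b') + (of u + of v) = of c := by
    rw [← h, ← hu, ← hv]; abel
  obtain ⟨c', hc'⟩ := exists_left_of_add_eq h1
  exact ⟨c', hc', le_of_add (hc' ▸ h1)⟩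

theorem le_of_add_le_add {a b c d e : E} (hb : of a + of b = of d) (hc : of a + of c = of e)
    (h : d ≤ e) : b ≤ c := by
  obtain ⟨u, hu⟩ := le_iff_of.1 h
  rw [← hb, add_assoc] at hu
  exact ⟨u, of_add_cancel hu hc⟩

end Basic

section Lattice

variable {E : Type*} [EffectAlgebra E] [LatticeEffectAlgebra E]

/-- `a \ b` is the difference of `a` and `a ⊓ b`. -/
noncomputable instance : SDiff E :=
  ⟨fun a b => (le_iff_of.1 (inf_le_left : a ⊓ b ≤ a)).choose⟩

theorem inf_add_sdiff (a b : E) : of (a ⊓ b) + of (a \ b) = of a :=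
  (le_iff_of.1 (inf_le_left : a ⊓ b ≤ a)).choose_spec

theorem sdiff_le' (a b : E) : a \ b ≤ a :=
  le_of_add ((add_comm _ _).trans (inf_add_sdiff a b))

theorem sdiff_eq_zero {a b : E} (h : a ≤ b) : a \ b = 0 := by
  have h1 := inf_add_sdiff a b
  rw [inf_eq_left.2 h] at h1
  exact of_injective (of_add_cancel h1 (by rw [of_zero, add_zero]))

theorem le_of_sdiff_eq_zero {a b : E} (h : a \ b = 0) : a ≤ b := by
  have h1 := inf_add_sdiff a b
  rw [h, of_zero, add_zero] at h1
  exact inf_eq_left.1 (of_injective h1)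

theorem add_sdiff_of_le {a b : E} (h : a ≤ b) : of a + of (b \ a) = of b := by
  have h1 := inf_add_sdiff b a
  rwa [inf_eq_right.2 h] at h1

theorem sdiff_inf_sdiff (a b : E) : (a \ b) ⊓ (b \ a) = 0 := by
  have ha := inf_add_sdiff a b
  have hb := inf_add_sdiff b a
  rw [inf_comm b a] at hb
  obtain ⟨c, hc, hca⟩ := exists_add_le le_rfl (inf_le_left : (a \ b) ⊓ (b \ a) ≤ a \ b) ha
  obtain ⟨d, hd, hdb⟩ := exists_add_le le_rfl (inf_le_right : (a \ b) ⊓ (b \ a) ≤ b \ a) hb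
  obtain rfl : c = d := of_injective (hc.symm.trans hd)
  obtain rfl : c = a ⊓ b := le_antisymm (le_inf hca hdb) (le_of_add hc)
  exact of_injective (of_add_cancel hc (by rw [of_zero, add_zero]))

/-- The difference of `r` and `r ⊓ t` lies below `r - p = q` and below `r - q = p`, hence vanishes.
-/
theorem le_of_inf_eq_zero {p q r t : E} (h : p ⊓ q = 0) (hr : of p + of q = of r)
    (hp : p ≤ t) (hq : q ≤ t) : r ≤ t := by
  have hpr : p ≤ r := le_of_add hr
  have hqr : q ≤ r := le_of_add ((add_comm _ _).trans hr)
  obtain ⟨v, hv⟩ := le_iff_of.1 (inf_le_left : r ⊓ t ≤ r)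
  obtain ⟨x, hx⟩ := le_iff_of.1 (le_inf hpr hp)
  obtain ⟨y, hy⟩ := le_iff_of.1 (le_inf hqr hq)
  have h1 : of v + of x = of q :=
    of_add_cancel (a := p) (c := r) (by rw [← hv, ← hx]; abel) hr
  have h2 : of v + of y = of p :=
    of_add_cancel (a := q) (c := r) (by rw [← hv, ← hy]; abel) ((add_comm _ _).trans hr)
  have hv0 : v = 0 := le_zero_iff'.1 (h ▸ le_inf (le_of_add h2) (le_of_add h1))
  rw [hv0, of_zero, add_zero] at hv
  exact inf_eq_left.1 (of_injective hv)

end Lattice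

/-! ### Riesz decomposition and prime ideals in MV-effect algebras -/

section MV

variable {E : Type*} [EffectAlgebra E] [MVEffectAlgebra E]

/-- The MV axiom makes `(a \ b) + (b \ a)` defined. This sum fits between `a ⊓ b` and `a ⊔ b`, so
adding it to `a ⊓ b` is also defined and gives an upper bound of `a` and `b` below `a ⊔ b`. -/
theorem add_sdiff (a b : E) : of a + of (b \ a) = of (a ⊔ b) := by
  have ha := inf_add_sdiff a b
  have hb := inf_add_sdiff b a
  rw [inf_comm b a] at hb
  obtain ⟨r, hr⟩ := Option.isSome_iff_exists.1
    (MVEffectAlgebra.isSome_padd_of_inf_eq_zero _ _ (sdiff_inf_sdiff a b))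
  change of (a \ b) + of (b \ a) = of r at hr
  obtain ⟨j, hj⟩ := le_iff_of.1 (inf_le_left.trans le_sup_left : a ⊓ b ≤ a ⊔ b)
  have hrj : r ≤ j := le_of_inf_eq_zero (sdiff_inf_sdiff a b) hr
    (le_of_add_le_add ha hj le_sup_left) (le_of_add_le_add hb hj le_sup_right)
  obtain ⟨w, hw, hwle⟩ := exists_add_le le_rfl hrj hj
  have hwa : of a + of (b \ a) = of w := by rw [← hw, ← hr, ← ha, add_assoc]
  have hwb : of b + of (a \ b) = of w := by rw [← hw, ← hr, ← hb]; abel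
  rw [hwa, le_antisymm hwle (sup_le (le_of_add hwa) (le_of_add hwb))]

/-- Riesz decomposition. -/
theorem exists_inf_add {a b c w : E} (h : of a + of b = of c) (hw : w ≤ c) :
    ∃ y ≤ b, of (w ⊓ a) + of y = of w :=
  ⟨w \ a, le_of_add_le_add (add_sdiff a w) h (sup_le (le_of_add h) hw), inf_add_sdiff w a⟩

/-- A proper prime ideal of an MV-effect algebra. -/
structure IsPrimeIdeal (P : Set E) : Prop where
  zero_mem : (0 : E) ∈ P
  mem_of_le : ∀ {a b : E}, a ≤ b → b ∈ P → a ∈ P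
  add_mem : ∀ {a b c : E}, a ∈ P → b ∈ P → of a + of b = of c → c ∈ P
  one_notMem : (1 : E) ∉ P
  mem_or_mem : ∀ {a b : E}, a ⊓ b = 0 → a ∈ P ∨ b ∈ P

/-- An ideal maximal among those avoiding `f` is prime. -/
theorem exists_isPrimeIdeal {f : E} (hf : f ≠ 0) : ∃ P : Set E, IsPrimeIdeal P ∧ f ∉ P := by
  let S : Set (Set E) := {P | (0 : E) ∈ P ∧ (∀ a b : E, a ≤ b → b ∈ P → a ∈ P) ∧
    (∀ a b c : E, a ∈ P → b ∈ P → of a + of b = of c → c ∈ P) ∧ f ∉ P}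
  have hS0 : ({0} : Set E) ∈ S := by
    refine ⟨rfl, ?_, ?_, hf⟩
    · rintro a b hab rfl
      exact le_zero_iff'.1 hab
    · rintro a b c rfl rfl h
      exact of_injective (by rw [← h, of_zero, add_zero])
  obtain ⟨P, -, hP⟩ := zorn_subset_nonempty S (by
    intro c hc hchain hne
    refine ⟨⋃₀ c, ⟨?_, ?_, ?_, ?_⟩, fun s hs => Set.subset_sUnion_of_mem hs⟩
    · obtain ⟨Q, hQ⟩ := hne
      exact ⟨Q, hQ, (hc hQ).1⟩
    · rintro a b hab ⟨Q, hQ, hb⟩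
      exact ⟨Q, hQ, (hc hQ).2.1 a b hab hb⟩
    · rintro a b d ⟨Q, hQ, ha⟩ ⟨R, hR, hb⟩ h
      rcases hchain.total hQ hR with hQR | hRQ
      · exact ⟨R, hR, (hc hR).2.2.1 a b d (hQR ha) hb h⟩
      · exact ⟨Q, hQ, (hc hQ).2.2.1 a b d ha (hRQ hb) h⟩
    · rintro ⟨Q, hQ, hfQ⟩
      exact (hc hQ).2.2.2 hfQ) {0} hS0
  obtain ⟨h0, hle, hadd, hfP⟩ := hP.prop
  have key : ∀ a b : E, a ⊓ b ∈ P → b ∉ P → f ⊓ a ∈ P := by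
    intro a b hab hb
    by_contra hfa
    -- This set is an ideal containing `P` and `b`. If it avoided `f`, maximality would force `b ∈
    -- P`.
    have hK : {z | z ⊓ a ∈ P} ∈ S := by
      refine ⟨hle _ _ inf_le_left h0, fun x y hxy hy => hle _ _ (inf_le_inf_right a hxy) hy,
        ?_, hfa⟩
      intro x y z hx hy h
      obtain ⟨v, hv, hvz⟩ := exists_inf_add h (inf_le_left : z ⊓ a ≤ z)
      refine hadd _ _ _ (hle _ _ (le_inf inf_le_right ?_) hx)
        (hle _ _ (le_inf hv ?_) hy) hvz
      · exact inf_le_left.trans inf_le_right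
      · exact (le_of_add ((add_comm _ _).trans hvz)).trans inf_le_right
    have hPK : P ⊆ {z | z ⊓ a ∈ P} := fun z hz => hle _ _ inf_le_left hz
    have := hP.le_of_ge hK hPK
    exact hb (this (by rwa [Set.mem_ofPred_eq, inf_comm]))
  refine ⟨P, ⟨h0, fun {a b} => hle a b, fun {a b c} => hadd a b c,
    fun h => hfP (hle _ _ (le_one' f) h), fun {a b} hab => ?_⟩, hfP⟩
  by_contra! hcon
  have h1 : f ⊓ a ∈ P := key a b (hab ▸ h0) hcon.2
  have h2 : f ⊓ f ∈ P := key f a h1 hcon.1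
  exact hfP (by rwa [inf_idem] at h2)

end MV

end EffectAlgebra

/-! ### Real values in the quotient by a prime ideal -/

namespace EffectAlgebra

open Filter Topology

section Square

variable {E : Type*} [EffectAlgebra E] [MVEffectAlgebra E]

/-- Truncated difference is monotone and 1-Lipschitz in its first argument, antitone and 1-Lipschitz
in its second. Hence `sq` respects congruence modulo an ideal. -/
theorem exists_sdiff_add_eq_left {a b p : E} (h : of a + of p = of b) (c : E) :
    ∃ q ≤ p, of (a \ c) + of q = of (b \ c) := by
  have hab : a ≤ b := le_of_add h
  obtain ⟨u, hu⟩ := le_iff_of.1 (inf_le_inf_right c hab)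
  obtain ⟨v, hv⟩ := le_iff_of.1 (le_of_add_le_add (add_sdiff c a) (add_sdiff c b)
    (sup_le_sup_left hab c))
  have h1 : of (a ⊓ c) + (of (a \ c) + of p) = of b := by
    rw [← add_assoc, inf_add_sdiff, h]
  have h2 : of (a ⊓ c) + (of (a \ c) + (of v + of u)) = of b := by
    rw [← inf_add_sdiff b c, ← hu, ← hv]; abel
  have h3 := of_add_cancel h2 h1
  obtain ⟨w, hw⟩ := exists_right_of_add_eq h1
  exact ⟨v, le_of_add (of_add_cancel (h3.trans hw) hw), hv⟩

theorem exists_sdiff_add_eq_right {c d p : E} (h : of c + of p = of d) (b : E) :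
    ∃ q ≤ p, of (b \ d) + of q = of (b \ c) := by
  obtain ⟨y, hy, hyd⟩ := exists_inf_add h (inf_le_right : b ⊓ d ≤ d)
  rw [inf_assoc, inf_eq_right.2 (le_of_add h)] at hyd
  refine ⟨y, hy, of_add_cancel (a := b ⊓ c) (c := b) ?_ (inf_add_sdiff b c)⟩
  rw [← inf_add_sdiff b d, ← hyd]; abel

/-- The element `2a - 1`, truncated at `0`. -/
noncomputable def sq (a : E) : E := a \ aᶜ

theorem sq_inf_sq_compl (a : E) : sq a ⊓ sq aᶜ = 0 := by
  rw [sq, sq, compl_compl']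
  exact sdiff_inf_sdiff a aᶜ

theorem sq_eq_zero {a : E} (h : a ≤ aᶜ) : sq a = 0 := sdiff_eq_zero h

theorem sq_compl_add {a : E} (h : a ≤ aᶜ) : of (sq aᶜ) + of a + of a = of 1 := by
  have h1 := add_sdiff_of_le h
  rw [sq, compl_compl', add_comm (of _) (of a), h1, add_comm, add_compl]

theorem sq_zero : sq (0 : E) = 0 := sq_eq_zero (zero_le' _)

theorem sq_one : sq (1 : E) = 1 := by
  have h := sq_compl_add (zero_le' (0 : E)ᶜ)
  rw [compl_zero', of_zero, add_zero, add_zero] at h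
  exact of_injective h

end Square

section Approx

variable {E : Type*} [EffectAlgebra E] [MVEffectAlgebra E] {P : Set E}

theorem IsPrimeIdeal.mem_iff (hP : IsPrimeIdeal P) {a b p : E} (hp : p ∈ P)
    (h : of a + of p = of b) : a ∈ P ↔ b ∈ P :=
  ⟨fun ha => hP.add_mem ha hp h, hP.mem_of_le (le_of_add h)⟩

theorem IsPrimeIdeal.exists_sq_add (hP : IsPrimeIdeal P) {a b p : E} (hp : p ∈ P)
    (h : of a + of p = of b) : ∃ q ∈ P, of (sq a) + of q = of (sq b) := by
  obtain ⟨q, hq, hqb⟩ := exists_sdiff_add_eq_left h aᶜ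
  obtain ⟨r, hr, hrb⟩ := exists_sdiff_add_eq_right (compl_add_of_add h) b
  have h1 : of (sq a) + (of q + of r) = of (sq b) := by
    rw [← add_assoc, sq, sq, hqb, hrb]
  obtain ⟨s, hs⟩ := exists_right_of_add_eq h1
  exact ⟨s, hP.add_mem (hP.mem_of_le hq hp) (hP.mem_of_le hr hp) hs, hs ▸ h1⟩

open Classical in
/-- Approximations, by binary expansion, of the real value of an element of the chain `E / P`. -/
noncomputable def approx (P : Set E) : ℕ → E → ℝ
  | 0, a => (1 + (if a ∈ P then 0 else 1) - (if aᶜ ∈ P then 0 else 1)) / 2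
  -- For a real value `v`, `2v - 1` is the difference of its positive part, the value of `sq a`, and
  -- its negative part, the value of `sq aᶜ`.
  | n + 1, a => (1 + approx P n (sq a) - approx P n (sq aᶜ)) / 2

theorem approx_succ (n : ℕ) (a : E) :
    approx P (n + 1) a = (1 + approx P n (sq a) - approx P n (sq aᶜ)) / 2 := rfl

theorem approx_compl (n : ℕ) (a : E) : approx P n aᶜ = 1 - approx P n a := by
  cases n <;> rw [approx, approx, compl_compl'] <;> ring

theorem approx_mem_Icc (n : ℕ) : ∀ a : E, approx P n a ∈ Set.Icc (0 : ℝ) 1 := by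
  induction n with
  | zero =>
    intro a
    simp only [approx]
    split_ifs <;> norm_num
  | succ n ih =>
    intro a
    have h1 := ih (sq a)
    have h2 := ih (sq aᶜ)
    rw [approx_succ]
    constructor <;> linarith [h1.1, h1.2, h2.1, h2.2]

theorem IsPrimeIdeal.approx_eq (hP : IsPrimeIdeal P) (n : ℕ) :
    ∀ {a b p : E}, p ∈ P → of a + of p = of b → approx P n a = approx P n b := by
  induction n with
  | zero =>
    intro a b p hp h
    rw [approx, approx, hP.mem_iff hp h, hP.mem_iff hp (compl_add_of_add h)]
  | succ n ih =>
    intro a b p hp h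
    obtain ⟨q, hq, hqb⟩ := hP.exists_sq_add hp h
    obtain ⟨r, hr, hrb⟩ := hP.exists_sq_add hp (compl_add_of_add h)
    rw [approx_succ, approx_succ, ih hq hqb, ih hr hrb]

theorem IsPrimeIdeal.approx_zero (hP : IsPrimeIdeal P) (n : ℕ) : approx P n 0 = 0 := by
  induction n with
  | zero => simp [approx, compl_zero', hP.zero_mem, hP.one_notMem]
  | succ n ih =>
    have h1 := approx_compl (P := P) n 0
    rw [compl_zero', ih] at h1
    rw [approx_succ, compl_zero', sq_zero, sq_one, h1, ih]
    norm_num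

theorem IsPrimeIdeal.approx_of_mem (hP : IsPrimeIdeal P) {a : E} (ha : a ∈ P) (n : ℕ) :
    approx P n a = 0 := by
  rw [← hP.approx_eq n ha (by rw [of_zero, zero_add]), hP.approx_zero]

/-- Here `d ≥ 1/2` modulo `P`. After a change by elements of `P`, `a' + b' = s ≤ 1/2` exactly, and
the doubled triple `2a', 2b', 1 - 2s` again sums to `1`; the error is half of the one for that
triple. -/
theorem IsPrimeIdeal.approx_succ_add_of_sq_compl_mem (hP : IsPrimeIdeal P) {n : ℕ} {δ : ℝ}
    (ih : ∀ a b d : E, of a + of b + of d = of 1 →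
      |approx P n a + approx P n b + approx P n d - 1| ≤ δ)
    {a b d : E} (h : of a + of b + of d = of 1) (hd : sq dᶜ ∈ P) :
    |approx P (n + 1) a + approx P (n + 1) b + approx P (n + 1) d - 1| ≤ δ / 2 := by
  obtain ⟨t, ht⟩ := exists_left_of_add_eq h
  obtain rfl : d = tᶜ := eq_compl_of_add (ht ▸ h)
  rw [compl_compl'] at hd
  have hs : of (t ⊓ tᶜ) + of (sq t) = of t := inf_add_sdiff t tᶜ
  obtain ⟨b', hb', hs'⟩ := exists_inf_add ht (inf_le_left : t ⊓ tᶜ ≤ t)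
  set s := t ⊓ tᶜ with hsdef
  obtain ⟨p, hp⟩ := le_iff_of.1 (inf_le_right : s ⊓ a ≤ a)
  obtain ⟨q, hq⟩ := le_iff_of.1 hb'
  set a' := s ⊓ a
  have hpq : of p + of q = of (sq t) := by
    refine of_add_cancel (a := s) (c := t) ?_ hs
    rw [← ht, ← hp, ← hq, ← hs']; abel
  have hpP : p ∈ P := hP.mem_of_le (le_of_add hpq) hd
  have hqP : q ∈ P := hP.mem_of_le (le_of_add ((add_comm _ _).trans hpq)) hd
  rw [← hP.approx_eq (n + 1) hpP hp, ← hP.approx_eq (n + 1) hqP hq,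
    hP.approx_eq (n + 1) hd (compl_add_of_add hs)]
  have hss : s ≤ sᶜ := inf_le_right.trans (compl_le_compl' inf_le_left)
  have has : a' ≤ s := le_of_add hs'
  have hbs : b' ≤ s := le_of_add ((add_comm _ _).trans hs')
  have haa : a' ≤ a'ᶜ := has.trans (hss.trans (compl_le_compl' has))
  have hbb : b' ≤ b'ᶜ := hbs.trans (hss.trans (compl_le_compl' hbs))
  have ha2 := add_compl (sq a'ᶜ)
  have hb2 := add_compl (sq b'ᶜ)
  have ha3 := of_add_cancel ha2 ((add_assoc _ _ _).symm.trans (sq_compl_add haa))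
  have hb3 := of_add_cancel hb2 ((add_assoc _ _ _).symm.trans (sq_compl_add hbb))
  have h1 : of (sq a'ᶜ)ᶜ + of (sq b'ᶜ)ᶜ + of (sq sᶜ) = of 1 := by
    rw [← sq_compl_add hss, ha3, hb3, ← hs']; abel
  have h2 := ih _ _ _ h1
  rw [approx_compl, approx_compl] at h2
  rw [approx_succ, approx_succ, approx_succ, compl_compl', sq_eq_zero haa, sq_eq_zero hbb,
    sq_eq_zero hss, hP.approx_zero]
  rw [abs_le] at h2 ⊢
  constructor <;> linarith [h2.1, h2.2]

/-- Here `a ≤ b ≤ d ≤ 1/2` modulo `P`, and the triple `1 - 2a, 1 - 2b, 1 - 2d` again sums to `1`. -/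
theorem IsPrimeIdeal.approx_succ_add_of_sdiff_mem (hP : IsPrimeIdeal P) {n : ℕ} {δ : ℝ}
    (ih : ∀ a b d : E, of a + of b + of d = of 1 →
      |approx P n a + approx P n b + approx P n d - 1| ≤ δ)
    {a b d : E} (h : of a + of b + of d = of 1) (hab : a \ b ∈ P) (hbd : b \ d ∈ P)
    (hd : sq d ∈ P) :
    |approx P (n + 1) a + approx P (n + 1) b + approx P (n + 1) d - 1| ≤ δ / 2 := by
  have hb1 := inf_add_sdiff b d
  have ha0 := inf_add_sdiff a b
  have ha1 := inf_add_sdiff (a ⊓ b) d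
  have habd : (a ⊓ b) \ d ∈ P := by
    obtain ⟨u, hu⟩ := le_iff_of.1 (inf_le_right : a ⊓ b ≤ b)
    obtain ⟨v, -, hv⟩ := exists_sdiff_add_eq_left hu d
    exact hP.mem_of_le (le_of_add hv) hbd
  have hle : a ⊓ b ⊓ d ≤ b ⊓ d := inf_le_inf_right d inf_le_right
  have hb1d : b ⊓ d ≤ d := inf_le_right
  set b1 := b ⊓ d
  set a1 := a ⊓ b ⊓ d
  -- The pieces cut off `a` and `b`, all in `P`, are moved to `d`, so that the sum stays exactly
  -- `1`.
  have hsum : of a1 + of b1 + (of d + (of (b \ d) + of (a \ b) + of ((a ⊓ b) \ d))) = of 1 := by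
    rw [← h, ← ha0, ← ha1, ← hb1]; abel
  obtain ⟨d1, hd1⟩ := exists_right_of_add_eq hsum
  obtain ⟨π, hπ⟩ := exists_right_of_add_eq hd1
  obtain ⟨π', hπ'⟩ := exists_left_of_add_eq hπ
  have hπP : π ∈ P := hP.add_mem (hP.add_mem hbd hab hπ') habd (hπ' ▸ hπ)
  rw [hd1] at hsum
  rw [hπ] at hd1
  obtain ⟨t, ht⟩ := exists_left_of_add_eq hsum
  have htd : of d1 + of t = of 1 := by rw [← ht, ← hsum, add_comm]
  obtain rfl : t = d1ᶜ := eq_compl_of_add htd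
  have hd2 : of (d1 ⊓ d1ᶜ) + of (sq d1) = of d1 := inf_add_sdiff d1 d1ᶜ
  have hσ : sq d1 ∈ P := by
    obtain ⟨q, hq, hqd⟩ := hP.exists_sq_add hπP hd1
    exact hP.add_mem hd hq hqd
  set σ := sq d1
  have hb1t : b1 ≤ d1ᶜ := le_of_add ((add_comm _ _).trans ht)
  have hb1d1 : b1 ≤ d1 := hb1d.trans (le_of_add hd1)
  have hd2t : d1 ⊓ d1ᶜ ≤ d1ᶜ := inf_le_right
  have hd2d : d1 ⊓ d1ᶜ ≤ d1 := inf_le_left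
  obtain ⟨q, hq⟩ := le_iff_of.1 (le_inf hb1d1 hb1t)
  set d2 := d1 ⊓ d1ᶜ
  obtain ⟨r, hr⟩ := le_iff_of.1 (le_of_add_le_add hq ((add_comm _ _).trans ht) hd2t)
  obtain ⟨p, hp⟩ := le_iff_of.1 hle
  have hda : a1 ≤ a1ᶜ := le_compl_iff.2 ((exists_add_le le_rfl hle ht).imp fun _ h => h.1)
  have hdb : b1 ≤ b1ᶜ := le_compl_iff.2 ((exists_add_le hb1d1 hb1t htd).imp fun _ h => h.1)
  have hdd : d2 ≤ d2ᶜ := le_compl_iff.2 ((exists_add_le hd2d hd2t htd).imp fun _ h => h.1)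
  have hone : of a1 + of b1 + (of d2 + of σ) = of 1 := by rw [hd2, hsum]
  -- With `p = b1 - a1`, `q = d2 - b1`, `r = a1 - q`, the elements `1 - 2a1`, `1 - 2b1`, `1 - 2d2`
  -- are written without subtraction; the last two each contain the surplus `σ ∈ P`, which is
  -- dropped in `hxvr`.
  have hx : of (sq a1ᶜ) = of p + of d2 + of σ := by
    refine of_add_cancel_add ((add_comm _ _).trans
      ((add_assoc _ _ _).symm.trans (sq_compl_add hda))) ?_
    rw [← hone, ← hp]; abel
  have hy : of (sq b1ᶜ) = of a1 + of q + of σ := by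
    refine of_add_cancel_add ((add_comm _ _).trans
      ((add_assoc _ _ _).symm.trans (sq_compl_add hdb))) ?_
    rw [← hone, ← hq]; abel
  have hz : of (sq d2ᶜ) = of r + of σ := by
    refine of_add_cancel_add ((add_comm _ _).trans
      ((add_assoc _ _ _).symm.trans (sq_compl_add hdd))) ?_
    rw [← hone, ← hr]
    nth_rewrite 1 [← hq]
    abel
  obtain ⟨v, hv⟩ := exists_left_of_add_eq hy.symm
  have hxvr : of (sq a1ᶜ) + of v + of r = of 1 := by
    rw [hx, ← hv, ← hone, ← hp]
    nth_rewrite 3 [← hr]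
    abel
  have h2 := ih _ _ _ hxvr
  rw [hv] at hy
  rw [hP.approx_eq n hσ hy.symm, hP.approx_eq n hσ hz.symm] at h2
  rw [← hP.approx_eq (n + 1) hab ha0, ← hP.approx_eq (n + 1) habd ha1,
    ← hP.approx_eq (n + 1) hbd hb1, hP.approx_eq (n + 1) hπP hd1,
    ← hP.approx_eq (n + 1) hσ hd2,
    approx_succ, approx_succ, approx_succ, sq_eq_zero hda, sq_eq_zero hdb,
    sq_eq_zero hdd, hP.approx_zero]
  rw [abs_le] at h2 ⊢
  constructor <;> linarith [h2.1, h2.2]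

theorem IsPrimeIdeal.sdiff_mem_or (hP : IsPrimeIdeal P) (a b : E) : a \ b ∈ P ∨ b \ a ∈ P :=
  hP.mem_or_mem (sdiff_inf_sdiff a b)

theorem IsPrimeIdeal.approx_add (hP : IsPrimeIdeal P) (n : ℕ) :
    ∀ a b d : E, of a + of b + of d = of 1 →
      |approx P n a + approx P n b + approx P n d - 1| ≤ 2 * (1 / 2) ^ n := by
  induction n with
  | zero =>
    intro a b d _
    have ha := approx_mem_Icc (P := P) 0 a
    have hb := approx_mem_Icc (P := P) 0 b
    have hd := approx_mem_Icc (P := P) 0 d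
    rw [abs_le]
    constructor <;> linarith [ha.1, ha.2, hb.1, hb.2, hd.1, hd.2]
  | succ n ih =>
    intro a b d h
    rw [pow_succ, ← mul_assoc, mul_one_div]
    have hacb : of a + of d + of b = of 1 := by rw [← h]; abel
    have hbac : of b + of a + of d = of 1 := by rw [← h]; abel
    have hbca : of b + of d + of a = of 1 := by rw [← h]; abel
    have hcab : of d + of a + of b = of 1 := by rw [← h]; abel
    have hcba : of d + of b + of a = of 1 := by rw [← h]; abel
    -- Either some entry is at least `1/2` modulo `P`, or all are at most `1/2` and the triple is
    -- sorted in the chain `E / P`.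
    rcases hP.mem_or_mem (sq_inf_sq_compl a) with ha | ha
    swap
    · convert hP.approx_succ_add_of_sq_compl_mem ih hbca ha using 2; ring
    rcases hP.mem_or_mem (sq_inf_sq_compl b) with hb | hb
    swap
    · convert hP.approx_succ_add_of_sq_compl_mem ih hacb hb using 2; ring
    rcases hP.mem_or_mem (sq_inf_sq_compl d) with hd | hd
    swap
    · exact hP.approx_succ_add_of_sq_compl_mem ih h hd
    rcases hP.sdiff_mem_or a b with h1 | h1 <;> rcases hP.sdiff_mem_or b d with h2 | h2 <;>
      rcases hP.sdiff_mem_or a d with h3 | h3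
    · exact hP.approx_succ_add_of_sdiff_mem ih h h1 h2 hd
    · exact hP.approx_succ_add_of_sdiff_mem ih h h1 h2 hd
    · convert hP.approx_succ_add_of_sdiff_mem ih hacb h3 h2 hb using 2; ring
    · convert hP.approx_succ_add_of_sdiff_mem ih hcab h3 h1 hb using 2; ring
    · convert hP.approx_succ_add_of_sdiff_mem ih hbac h1 h3 hd using 2; ring
    · convert hP.approx_succ_add_of_sdiff_mem ih hbca h2 h3 ha using 2; ring
    · convert hP.approx_succ_add_of_sdiff_mem ih hcba h2 h1 ha using 2; ring
    · convert hP.approx_succ_add_of_sdiff_mem ih hcba h2 h1 ha using 2; ring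

end Approx

/-! ### Real points, and enough of them -/

section Point

variable {E : Type*} [EffectAlgebra E]

/-- A real point of a lattice effect algebra: a state that preserves binary infima. -/
structure IsPoint [LatticeEffectAlgebra E] (φ : E → ℝ) : Prop where
  nonneg : ∀ a, 0 ≤ φ a
  map_one : φ 1 = 1
  map_add : ∀ {a b c : E}, of a + of b = of c → φ c = φ a + φ b
  map_inf : ∀ a b, φ (a ⊓ b) = min (φ a) (φ b)

theorem IsPrimeIdeal.exists_isPoint [MVEffectAlgebra E] {P : Set E} (hP : IsPrimeIdeal P) :
    ∃ φ : E → ℝ, IsPoint φ ∧ ∀ a ∈ P, φ a = 0 := by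
  have hlim : ∀ a : E, ∃ x ∈ Set.Icc (0 : ℝ) 1,
      Tendsto (fun n : ℕ => approx P n a) (hyperfilter ℕ) (𝓝 x) := fun a =>
    isCompact_Icc.ultrafilter_le_nhds ((hyperfilter ℕ).map fun n : ℕ => approx P n a)
      (tendsto_principal.2 (Eventually.of_forall fun n => approx_mem_Icc n a))
  choose φ hφ hlim using hlim
  have hmem : ∀ a ∈ P, φ a = 0 := fun a ha =>
    tendsto_nhds_unique (hlim a) (by simp only [hP.approx_of_mem ha, tendsto_const_nhds])
  have hcompl : ∀ a, φ aᶜ = 1 - φ a := fun a =>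
    tendsto_nhds_unique (hlim aᶜ) (by simpa only [approx_compl] using (hlim a).const_sub 1)
  have hadd : ∀ {a b c : E}, of a + of b = of c → φ c = φ a + φ b := by
    intro a b c h
    have h1 := (((hlim a).add (hlim b)).add (hlim cᶜ)).sub_const 1
    have h2 : Tendsto (fun n : ℕ => 2 * (1 / 2 : ℝ) ^ n) (hyperfilter ℕ) (𝓝 (2 * 0)) :=
      ((tendsto_pow_atTop_nhds_zero_of_lt_one (by norm_num) (by norm_num)).const_mul 2).mono_left
        Nat.hyperfilter_le_atTop
    rw [mul_zero] at h2
    have h3 := squeeze_zero_norm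
      (f := fun n : ℕ => approx P n a + approx P n b + approx P n cᶜ - 1)
      (fun n => hP.approx_add n a b cᶜ (by rw [h, add_compl])) h2
    have h4 := tendsto_nhds_unique h1 h3
    rw [hcompl] at h4
    linarith
  have hmono : ∀ {a b : E}, a ≤ b → φ a ≤ φ b := by
    intro a b h
    obtain ⟨c, hc⟩ := le_iff_of.1 h
    rw [hadd hc]
    linarith [(hφ c).1]
  refine ⟨φ, ⟨fun a => (hφ a).1, ?_, hadd, fun a b => ?_⟩, hmem⟩
  · rw [← compl_zero', hcompl, hmem 0 hP.zero_mem, sub_zero]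
  · have ha := hadd (inf_add_sdiff a b)
    have hb := hadd (inf_add_sdiff b a)
    rw [inf_comm b a] at hb
    have hla : φ (a ⊓ b) ≤ φ a := hmono inf_le_left
    have hlb : φ (a ⊓ b) ≤ φ b := hmono inf_le_right
    -- Since `φ` kills `P`, one of the two differences has value `0`.
    rcases hP.sdiff_mem_or a b with h | h
    · rw [hmem _ h, add_zero] at ha
      rw [← ha, min_eq_left (ha ▸ hlb)]
    · rw [hmem _ h, add_zero] at hb
      rw [← hb, min_eq_right (hb ▸ hla)]

namespace IsPoint

variable {φ : E → ℝ}

theorem map_zero [LatticeEffectAlgebra E] (hφ : IsPoint φ) : φ 0 = 0 := by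
  have := hφ.map_add (show of (0 : E) + of 0 = of 0 by rw [of_zero, add_zero])
  linarith

theorem mono [LatticeEffectAlgebra E] (hφ : IsPoint φ) {a b : E} (h : a ≤ b) : φ a ≤ φ b := by
  obtain ⟨c, hc⟩ := le_iff_of.1 h
  rw [hφ.map_add hc]
  linarith [hφ.nonneg c]

theorem le_one [LatticeEffectAlgebra E] (hφ : IsPoint φ) (a : E) : φ a ≤ 1 :=
  hφ.map_one ▸ hφ.mono (le_one' a)

theorem map_compl [LatticeEffectAlgebra E] (hφ : IsPoint φ) (a : E) : φ aᶜ = 1 - φ a := by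
  linarith [hφ.map_add (add_compl a), hφ.map_one]

theorem map_sdiff [LatticeEffectAlgebra E] (hφ : IsPoint φ) (a b : E) :
    φ (a \ b) = max 0 (φ a - φ b) := by
  have h := hφ.map_add (inf_add_sdiff a b)
  rw [hφ.map_inf] at h
  rcases le_total (φ a) (φ b) with h1 | h1
  · rw [min_eq_left h1] at h
    rw [max_eq_left (by linarith)]; linarith
  · rw [min_eq_right h1] at h
    rw [max_eq_right (by linarith)]; linarith

theorem map_sup [MVEffectAlgebra E] (hφ : IsPoint φ) (a b : E) :
    φ (a ⊔ b) = max (φ a) (φ b) := by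
  have h := hφ.map_add (add_sdiff a b)
  rw [h, hφ.map_sdiff]
  rcases le_total (φ a) (φ b) with h1 | h1
  · rw [max_eq_right h1, max_eq_right (by linarith)]; ring
  · rw [max_eq_left h1, max_eq_left (by linarith)]; ring

theorem map_sq [MVEffectAlgebra E] (hφ : IsPoint φ) (a : E) :
    φ (sq a) = max 0 (2 * φ a - 1) := by
  rw [sq, hφ.map_sdiff, hφ.map_compl]
  congr 1; ring

end IsPoint

/-- Otherwise all multiples of `e` exist, and their supremum `s` satisfies `s ≤ s - e`: the
Archimedean property. -/
theorem exists_nsmul_not_le_compl [SigmaMVEffectAlgebra E] {e : E} (he : e ≠ 0) :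
    ∃ (n : ℕ) (x : E), n • of e = of x ∧ ¬ x ≤ eᶜ := by
  by_contra! hcon
  have hex : ∀ n : ℕ, ∃ x : E, n • of e = of x := by
    intro n
    induction n with
    | zero => exact ⟨0, zero_nsmul _⟩
    | succ n ih =>
      obtain ⟨x, hx⟩ := ih
      obtain ⟨y, hy⟩ := le_compl_iff.1 (hcon n x hx)
      exact ⟨y, by rw [succ_nsmul, hx, hy]⟩
  choose f hf using hex
  have hlub := SigmaMVEffectAlgebra.isLUB_countableSup f
  set s := SigmaMVEffectAlgebra.countableSup f
  have hstep : ∀ n, of e + of (f n) = of (f (n + 1)) := fun n => by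
    rw [← hf, ← hf, succ_nsmul, add_comm]
  have hes : e ≤ s := (le_of_add (hstep 0)).trans (hlub.1 ⟨1, rfl⟩)
  have hadd := add_sdiff_of_le hes
  have hle : s ≤ s \ e := hlub.2 (by
    rintro _ ⟨n, rfl⟩
    exact le_of_add_le_add (hstep n) hadd (hlub.1 ⟨n + 1, rfl⟩))
  rw [le_antisymm (sdiff_le' s e) hle, add_comm] at hadd
  exact he (of_injective (of_add_cancel hadd (by rw [of_zero, add_zero])))

theorem exists_isPoint_pos [SigmaMVEffectAlgebra E] {e : E} (he : e ≠ 0) :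
    ∃ φ : E → ℝ, IsPoint φ ∧ 0 < φ e := by
  obtain ⟨n, x, hx, hxe⟩ := exists_nsmul_not_le_compl he
  obtain ⟨P, hP, hxP⟩ := exists_isPrimeIdeal (mt le_of_sdiff_eq_zero hxe)
  obtain ⟨φ, hφ, hφP⟩ := hP.exists_isPoint
  refine ⟨φ, hφ, (hφ.nonneg e).lt_of_ne' fun h0 => ?_⟩
  have hn : ∀ (n : ℕ) (x : E), n • of e = of x → φ x = 0 := by
    intro n
    induction n with
    | zero =>
      intro x hx
      rw [zero_nsmul, ← of_zero] at hx
      rw [← of_injective hx, hφ.map_zero]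
    | succ n ih =>
      intro x hx
      rw [succ_nsmul] at hx
      obtain ⟨y, hy⟩ := exists_left_of_add_eq hx
      rw [hy] at hx
      rw [hφ.map_add hx, ih y hy, h0, add_zero]
  -- Now `φ eᶜ ≤ φ x`. With `φ e = 0`, and hence `φ x = 0`, this reads `1 ≤ 0`.
  have h1 := hφP _ ((hP.sdiff_mem_or x eᶜ).resolve_left hxP)
  rw [hφ.map_sdiff, hφ.map_compl, h0, hn n x hx] at h1
  norm_num at h1

end Point

end EffectAlgebra

/-! ### The compact space of points and Baire category -/

namespace EffectAlgebra

open Filter Topology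

/-- The space of real points of a lattice effect algebra, with the topology of pointwise
convergence. -/
abbrev Point (E : Type*) [EffectAlgebra E] [LatticeEffectAlgebra E] : Type _ :=
  {φ : E → ℝ // IsPoint φ}

theorem isClosed_setOf_isPoint (E : Type*) [EffectAlgebra E] [LatticeEffectAlgebra E] :
    IsClosed {φ : E → ℝ | IsPoint φ} := by
  have : {φ : E → ℝ | IsPoint φ} = (⋂ a : E, {φ | 0 ≤ φ a}) ∩ {φ | φ 1 = 1} ∩
      (⋂ (a : E) (b : E) (c : E) (_ : of a + of b = of c), {φ | φ c = φ a + φ b}) ∩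
      ⋂ (a : E) (b : E), {φ | φ (a ⊓ b) = min (φ a) (φ b)} := by
    ext φ
    simp only [Set.mem_inter_iff, Set.mem_iInter, Set.mem_ofPred_eq]
    exact ⟨fun h => ⟨⟨⟨h.nonneg, h.map_one⟩, fun _ _ _ => h.map_add⟩, h.map_inf⟩,
      fun h => ⟨h.1.1.1, h.1.1.2, fun {a b c} => h.1.2 a b c, h.2⟩⟩
  rw [this]
  refine ((isClosed_iInter fun a => ?_).inter ?_).inter ?_ |>.inter ?_
  · exact isClosed_le continuous_const (continuous_apply a)
  · exact isClosed_eq (continuous_apply 1) continuous_const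
  · exact isClosed_iInter fun a => isClosed_iInter fun b => isClosed_iInter fun c =>
      isClosed_iInter fun _ => isClosed_eq (continuous_apply c)
        ((continuous_apply a).add (continuous_apply b))
  · exact isClosed_iInter fun a => isClosed_iInter fun b => isClosed_eq (continuous_apply _)
      ((continuous_apply a).min (continuous_apply b))

instance (E : Type*) [EffectAlgebra E] [LatticeEffectAlgebra E] : CompactSpace (Point E) := by
  refine isCompact_iff_compactSpace.1 (IsCompact.of_isClosed_subset
    (isCompact_univ_pi fun _ : E => isCompact_Icc (a := (0 : ℝ)) (b := 1))
    (isClosed_setOf_isPoint E) fun φ (hφ : IsPoint φ) a _ => ⟨hφ.nonneg a, hφ.le_one a⟩)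

section Topology

variable {E : Type*} [EffectAlgebra E]

theorem continuous_point_apply [LatticeEffectAlgebra E] (a : E) :
    Continuous fun φ : Point E => φ.1 a :=
  (continuous_apply a).comp continuous_subtype_val

/-- Doubling, by `2a - 1` or by `2a`, doubles the gap between `r` and `φ₀ a` until `1/2` separates
them, where `sq a` serves as `e`, or until `r < 0`. -/
theorem exists_pos_imp_lt [MVEffectAlgebra E] (φ₀ : Point E) (n : ℕ) :
    ∀ (a : E) (r : ℝ), r + (1 / 2) ^ n < φ₀.1 a →
      ∃ e : E, 0 < φ₀.1 e ∧ ∀ φ : Point E, 0 < φ.1 e → r < φ.1 a := by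
  induction n with
  | zero =>
    intro a r h
    refine ⟨1, by rw [φ₀.2.map_one]; exact one_pos, fun φ _ => ?_⟩
    rw [pow_zero] at h
    linarith [φ₀.2.le_one a, φ.2.nonneg a]
  | succ n ih =>
    intro a r h
    rw [pow_succ] at h
    have hpos : (0 : ℝ) < (1 / 2) ^ n := by positivity
    rcases le_total (1 / 2) r with hr | hr
    · obtain ⟨e, he, hlt⟩ := ih (sq a) (2 * r - 1) (by
        rw [φ₀.2.map_sq]; exact lt_max_of_lt_right (by linarith))
      refine ⟨e, he, fun φ hφ => ?_⟩
      have := hlt φ hφ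
      rw [φ.2.map_sq, lt_max_iff] at this
      rcases this with h | h <;> linarith
    rcases lt_or_ge (1 / 2) (φ₀.1 a) with h1 | h1
    · refine ⟨sq a, ?_, fun φ hφ => ?_⟩
      · rw [φ₀.2.map_sq]; exact lt_max_of_lt_right (by linarith)
      · rw [φ.2.map_sq, lt_max_iff] at hφ
        rcases hφ with h | h <;> linarith
    -- `(sq aᶜ)ᶜ` is `2a` truncated at `1`.
    · obtain ⟨e, he, hlt⟩ := ih (sq aᶜ)ᶜ (2 * r) (by
        rw [φ₀.2.map_compl, φ₀.2.map_sq, φ₀.2.map_compl, max_eq_right (by linarith)]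
        linarith)
      refine ⟨e, he, fun φ hφ => ?_⟩
      have := hlt φ hφ
      rw [φ.2.map_compl, φ.2.map_sq, φ.2.map_compl] at this
      linarith [le_max_right 0 (2 * (1 - φ.1 a) - 1)]

/-- The sets on which an element is positive form a base of the space of points. -/
theorem exists_pos_subset_of_mem_nhds [MVEffectAlgebra E] {φ₀ : Point E} {U : Set (Point E)}
    (hU : U ∈ 𝓝 φ₀) : ∃ e : E, 0 < φ₀.1 e ∧ ∀ φ : Point E, 0 < φ.1 e → φ ∈ U := by
  let L : Filter (Point E) :=
    { sets := {S | ∃ e : E, 0 < φ₀.1 e ∧ ∀ φ : Point E, 0 < φ.1 e → φ ∈ S}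
      univ_sets := ⟨1, by rw [φ₀.2.map_one]; exact one_pos, fun _ _ => trivial⟩
      sets_of_superset := fun ⟨e, he, h⟩ hST => ⟨e, he, fun φ hφ => hST (h φ hφ)⟩
      inter_sets := fun ⟨e, he, h⟩ ⟨f, hf, h'⟩ => ⟨e ⊓ f, by
          rw [φ₀.2.map_inf]; exact lt_min he hf, fun φ hφ => by
          rw [φ.2.map_inf, lt_min_iff] at hφ
          exact ⟨h φ hφ.1, h' φ hφ.2⟩⟩ }
  have hlow : ∀ (a : E) (r : ℝ), r < φ₀.1 a → ∀ᶠ φ in L, r < φ.1 a := by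
    intro a r hr
    obtain ⟨n, hn⟩ := exists_pow_lt_of_lt_one (sub_pos.2 hr) (by norm_num : (1 / 2 : ℝ) < 1)
    exact exists_pos_imp_lt φ₀ n a r (by linarith)
  suffices h : L ≤ 𝓝 φ₀ from h hU
  refine tendsto_subtype_rng.2 (tendsto_pi_nhds.2 fun a => tendsto_order.2 ⟨hlow a, ?_⟩)
  intro r hr
  filter_upwards [hlow aᶜ (1 - r) (by rw [φ₀.2.map_compl]; linarith)] with φ hφ
  rw [φ.2.map_compl] at hφ
  linarith

end Topology

section Residual

variable {E : Type*} [EffectAlgebra E] [SigmaMVEffectAlgebra E]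

theorem eq_zero_of_forall_point {e : E} (h : ∀ φ : Point E, φ.1 e ≤ 0) : e = 0 := by
  by_contra he
  obtain ⟨φ, hφ, hpos⟩ := exists_isPoint_pos he
  exact (h ⟨φ, hφ⟩).not_gt hpos

theorem le_of_forall_point {a b : E} (h : ∀ φ : Point E, φ.1 a ≤ φ.1 b) : a ≤ b :=
  le_of_sdiff_eq_zero (eq_zero_of_forall_point fun φ => by
    rw [φ.2.map_sdiff]; exact max_le le_rfl (by linarith [h φ]))

theorem le_of_eventually_point {a b : E} (h : ∀ᶠ φ in residual (Point E), φ.1 a ≤ φ.1 b) :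
    a ≤ b := by
  refine le_of_forall_point fun φ => ?_
  exact (isClosed_le (continuous_point_apply a) (continuous_point_apply b)).closure_subset_iff.2
    subset_rfl (dense_of_mem_residual h φ)

theorem eq_of_eventually_point {a b : E} (h : ∀ᶠ φ in residual (Point E), φ.1 a = φ.1 b) :
    a = b :=
  le_antisymm (le_of_eventually_point (h.mono fun _ h => h.le))
    (le_of_eventually_point (h.mono fun _ h => h.ge))

theorem isGLB_double {d : ℕ → E} (hd : Antitone d) (h0 : IsGLB (Set.range d) 0) :
    IsGLB (Set.range fun n => (sq (d n)ᶜ)ᶜ) 0 := by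
  refine ⟨fun _ _ => zero_le' _, fun z hz => h0.2 ?_⟩
  have hval : ∀ (φ : Point E) (n : ℕ), φ.1 z ≤ 2 * φ.1 (d n) := fun φ n => by
    have h1 := φ.2.mono (hz ⟨n, rfl⟩)
    simp only [φ.2.map_compl, φ.2.map_sq] at h1
    linarith [le_max_right 0 (2 * (1 - φ.1 (d n)) - 1)]
  rintro _ ⟨n, rfl⟩
  -- From `z ≤ 2 d_k` with `k = max n m` it follows that `z - d_n ≤ d_k ≤ d_m` for every `m`, so `z
  -- \ d n = 0`.
  refine le_of_sdiff_eq_zero (le_zero_iff'.1 (h0.2 ?_))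
  rintro _ ⟨m, rfl⟩
  refine le_of_forall_point fun φ => ?_
  rw [φ.2.map_sdiff]
  have h1 := φ.2.mono (hd (le_max_left n m))
  have h2 := φ.2.mono (hd (le_max_right n m))
  have h3 := hval φ (max n m)
  exact max_le (φ.2.nonneg _) (by linarith)

/-- Doubling `d` a total of `k` times keeps its infimum `0` and raises the lower bound to `1`
wherever `e` is positive, so `e` lies below every term. -/
theorem eq_zero_of_forall_pow_le (k : ℕ) : ∀ {d : ℕ → E}, Antitone d →
    IsGLB (Set.range d) 0 → ∀ e : E,
    (∀ φ : Point E, 0 < φ.1 e → ∀ n, (1 / 2) ^ k ≤ φ.1 (d n)) → e = 0 := by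
  induction k with
  | zero =>
    intro d _ h0 e he
    refine le_zero_iff'.1 (h0.2 ?_)
    rintro _ ⟨n, rfl⟩
    refine le_of_forall_point fun φ => ?_
    rcases (φ.2.nonneg e).eq_or_lt with h | h
    · rw [← h]; exact φ.2.nonneg _
    · exact (φ.2.le_one e).trans (by simpa using he φ h n)
  | succ k ih =>
    intro d hd h0 e he
    refine ih (fun n m hnm => le_of_forall_point fun φ => ?_) (isGLB_double hd h0) e
      fun φ hφ n => ?_
    · simp only [φ.2.map_compl, φ.2.map_sq]
      have := φ.2.mono (hd hnm)
      gcongr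
    · have h1 := he φ hφ n
      rw [φ.2.map_compl, φ.2.map_sq, φ.2.map_compl]
      rw [pow_succ] at h1
      have h2 : (1 / 2 : ℝ) ^ k ≤ 1 := pow_le_one₀ (by norm_num) (by norm_num)
      rcases max_choice 0 (2 * (1 - φ.1 (d n)) - 1) with h | h <;> rw [h] <;> linarith

theorem IsPoint.partialSups_le {φ : E → ℝ} (hφ : IsPoint φ) {a : ℕ → E} {u : ℝ}
    (h : ∀ n, φ (a n) ≤ u) (n : ℕ) : φ (partialSups a n) ≤ u := by
  induction n with
  | zero => rw [partialSups_zero]; exact h 0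
  | succ n ih => rw [partialSups_add_one, hφ.map_sup]; exact max_le ih (h _)

/-- The set of such points is open. If it missed a neighbourhood, it would miss a basic set on which
some `e` is positive, and there `s - a n ≥ 2⁻ᵏ` for all `n`, forcing `e = 0`. -/
theorem eventually_exists_lt {a : ℕ → E} {s : E} (ha : Monotone a)
    (hs : IsLUB (Set.range a) s) (k : ℕ) :
    ∀ᶠ φ in residual (Point E), ∃ n, φ.1 s - φ.1 (a n) < (1 / 2) ^ k := by
  have has : ∀ n, a n ≤ s := fun n => hs.1 ⟨n, rfl⟩
  have hval : ∀ (φ : Point E) n, φ.1 (s \ a n) = φ.1 s - φ.1 (a n) := fun φ n => by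
    rw [φ.2.map_sdiff, max_eq_right (sub_nonneg.2 (φ.2.mono (has n)))]
  have hd : Antitone fun n => s \ a n := fun n m hnm => le_of_forall_point fun φ => by
    rw [hval, hval]; linarith [φ.2.mono (ha hnm)]
  have h0 : IsGLB (Set.range fun n => s \ a n) 0 := by
    refine ⟨fun _ _ => zero_le' _, fun z hz => ?_⟩
    have hsz : s ≤ s \ z := hs.2 (by
      rintro _ ⟨n, rfl⟩
      refine le_of_forall_point fun φ => ?_
      have := φ.2.mono (hz ⟨n, rfl⟩)
      simp only [hval] at this
      rw [φ.2.map_sdiff]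
      exact le_max_of_le_right (by linarith))
    refine le_of_forall_point fun φ => ?_
    have h1 := φ.2.mono hsz
    have h2 := φ.2.mono ((hz ⟨0, rfl⟩).trans (sdiff_le' s (a 0)))
    rw [φ.2.map_sdiff, max_eq_right (by linarith)] at h1
    rw [φ.2.map_zero]; linarith
  have hopen : IsOpen {φ : Point E | ∃ n, φ.1 s - φ.1 (a n) < (1 / 2) ^ k} := by
    simp only [Set.ofPred_exists]
    exact isOpen_iUnion fun n => isOpen_lt
      ((continuous_point_apply s).sub (continuous_point_apply (a n))) continuous_const
  refine residual_of_dense_open hopen fun φ₀ => mem_closure_iff_nhds.2 fun U hU => ?_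
  obtain ⟨e, he, heU⟩ := exists_pos_subset_of_mem_nhds hU
  by_contra hcon
  have hbig : ∀ φ : Point E, 0 < φ.1 e → ∀ n, (1 / 2) ^ k ≤ φ.1 (s \ a n) := by
    intro φ hφ n
    rw [hval]
    by_contra hlt
    exact hcon ⟨φ, heU φ hφ, n, not_le.1 hlt⟩
  rw [eq_zero_of_forall_pow_le k hd h0 e hbig, φ₀.2.map_zero] at he
  exact he.false

/-- Almost all points, in the sense of category, preserve a given countable supremum. -/
theorem eventually_isLUB {ι : Type*} [Countable ι] [Nonempty ι] {a : ι → E} {s : E}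
    (hs : IsLUB (Set.range a) s) :
    ∀ᶠ φ in residual (Point E), IsLUB (Set.range fun i => φ.1 (a i)) (φ.1 s) := by
  obtain ⟨f, hf⟩ := exists_surjective_nat ι
  have hs' : IsLUB (Set.range (partialSups (a ∘ f))) s := by
    rw [IsLUB, upperBounds_range_partialSups, hf.range_comp]
    exact hs
  filter_upwards [eventually_countable_forall.2
    (eventually_exists_lt (partialSups (a ∘ f)).monotone hs')] with φ hφ
  refine ⟨?_, fun u hu => le_of_forall_pos_lt_add fun ε hε => ?_⟩
  · rintro _ ⟨i, rfl⟩
    exact φ.2.mono (hs.1 ⟨i, rfl⟩)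
  · obtain ⟨k, hk⟩ := exists_pow_lt_of_lt_one hε (by norm_num : (1 / 2 : ℝ) < 1)
    obtain ⟨n, hn⟩ := hφ k
    have := φ.2.partialSups_le (a := a ∘ f) (fun n => hu ⟨f n, rfl⟩) n
    linarith

end Residual

end EffectAlgebra

/-! ### Observables and their spectral resolutions -/

section Observable

open EffectAlgebra MeasureTheory Filter Topology

namespace Observable

section Basic

variable {E : Type*} [EffectAlgebra E] (x : Observable E)

theorem add_of_disjoint {A B C : BorelSet} (h : Disjoint A.1 B.1) (hC : C.1 = A.1 ∪ B.1) :
    of (x.toFun A) + of (x.toFun B) = of (x.toFun C) := by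
  have : C = ⟨A.1 ∪ B.1, A.2.union B.2⟩ := Subtype.ext hC
  rw [this]
  exact x.map_union A B h

theorem mono {A B : BorelSet} (h : A.1 ⊆ B.1) : x.toFun A ≤ x.toFun B :=
  le_of_add (x.add_of_disjoint (A := A) (B := ⟨B.1 \ A.1, B.2.diff A.2⟩) (C := B)
    Set.disjoint_sdiff_right (Set.union_sdiff_cancel h).symm)

theorem map_compl (A : BorelSet) : x.toFun ⟨A.1ᶜ, A.2.compl⟩ = (x.toFun A)ᶜ :=
  eq_compl_of_add (by
    rw [← x.map_univ]
    exact x.add_of_disjoint disjoint_compl_right (Set.union_compl_self _).symm)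

theorem map_empty : x.toFun ⟨∅, MeasurableSet.empty⟩ = 0 := by
  have h := x.map_compl ⟨Set.univ, MeasurableSet.univ⟩
  rw [x.map_univ, compl_one'] at h
  rw [← h]
  congr 2
  exact Set.compl_univ.symm

theorem isLUB_of_iUnion {A : ℕ → BorelSet} {C : BorelSet} (hA : ∀ i, (A i).1 ⊆ (A (i + 1)).1)
    (hC : C.1 = ⋃ i, (A i).1) : IsLUB (Set.range fun i => x.toFun (A i)) (x.toFun C) := by
  have : C = ⟨⋃ i, (A i).1, MeasurableSet.iUnion fun i => (A i).2⟩ := Subtype.ext hC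
  rw [this]
  exact x.map_iUnion A hA

theorem resolution_mono : Monotone x.resolution := fun _ _ h => x.mono (Set.Iio_subset_Iio h)

/-- An observable is determined by its spectral resolution. -/
theorem eq_of_resolution_eq {x y : Observable E} (h : ∀ t, x.resolution t = y.resolution t) :
    x = y := by
  refine Observable.ext (funext fun A => ?_)
  obtain ⟨A, hA⟩ := A
  induction A, hA using MeasurableSpace.induction_on_inter
    ((BorelSpace.measurable_eq (α := ℝ)).trans (borel_eq_generateFrom_Iio ℝ))
    isPiSystem_Iio with
  | empty => rw [x.map_empty, y.map_empty]
  | basic A hA =>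
    obtain ⟨t, rfl⟩ := hA
    exact h t
  | compl A hA ih => rw [x.map_compl ⟨A, hA⟩, y.map_compl ⟨A, hA⟩, ih]
  | iUnion f hd hf ih =>
    let S : ℕ → BorelSet := fun n =>
      ⟨⋃ i ∈ Set.Iio n, f i, MeasurableSet.biUnion (Set.to_countable _) fun i _ => hf i⟩
    have hS : ∀ n, (S (n + 1)).1 = (S n).1 ∪ f n := fun n => by
      ext t
      simp only [S, Set.mem_iUnion, Set.mem_union, Set.mem_Iio, Nat.lt_succ_iff_lt_or_eq]
      constructor
      · rintro ⟨i, hi | rfl, ht⟩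
        exacts [.inl ⟨i, hi, ht⟩, .inr ht]
      · rintro (⟨i, hi, ht⟩ | ht)
        exacts [⟨i, .inl hi, ht⟩, ⟨n, .inr rfl, ht⟩]
    have hdisj : ∀ n, Disjoint (S n).1 (f n) := fun n =>
      Set.disjoint_iUnion₂_left.2 fun i hi => hd (ne_of_lt hi)
    have hU : (⋃ i, f i) = ⋃ n, (S n).1 := by
      ext t
      simp only [S, Set.mem_iUnion, Set.mem_Iio]
      exact ⟨fun ⟨i, hi⟩ => ⟨i + 1, i, i.lt_succ_self, hi⟩, fun ⟨_, i, _, hi⟩ => ⟨i, hi⟩⟩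
    have hxy : ∀ n, x.toFun (S n) = y.toFun (S n) := by
      intro n
      induction n with
      | zero =>
        have : S 0 = ⟨∅, MeasurableSet.empty⟩ := Subtype.ext (by simp [S])
        rw [this, x.map_empty, y.map_empty]
      | succ n ihn =>
        have hx := x.add_of_disjoint (B := ⟨f n, hf n⟩) (hdisj n) (hS n)
        have hy := y.add_of_disjoint (B := ⟨f n, hf n⟩) (hdisj n) (hS n)
        rw [ihn, ih n] at hx
        exact of_injective (hx.symm.trans hy)
    have hmono : ∀ n, (S n).1 ⊆ (S (n + 1)).1 := fun n => hS n ▸ Set.subset_union_left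
    have hx := x.isLUB_of_iUnion (C := ⟨_, MeasurableSet.iUnion hf⟩) hmono hU
    have hy := y.isLUB_of_iUnion (C := ⟨_, MeasurableSet.iUnion hf⟩) hmono hU
    simp only [hxy] at hx
    exact hx.unique hy

theorem IsBounded.exists_resolution {x : Observable E} (hx : x.IsBounded) :
    ∃ α β : ℝ, (∀ t ≤ α, x.resolution t = 0) ∧ ∀ t > β, x.resolution t = 1 := by
  obtain ⟨α, β, -, h⟩ := hx
  refine ⟨α, β, fun t ht => eq_zero_of_padd_one _ ?_, fun t ht => le_antisymm (le_one' _) ?_⟩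
  -- Disjointness makes `x.resolution t + 1` defined, so the last effect algebra axiom applies.
  · rw [← h, resolution, x.map_union _ _ (Set.disjoint_left.2 fun s hs hs' =>
      (hs.trans_le ht).not_ge hs'.1)]
    rfl
  · rw [← h]
    exact x.mono fun s hs => hs.2.trans_lt ht

theorem isBounded_of_resolution {x : Observable E} {α β : ℝ} (hα : x.resolution α = 0)
    (hβ : x.resolution β = 1) : x.IsBounded := by
  have h1 : x.resolution (max α β) = 1 :=
    le_antisymm (le_one' _) (hβ ▸ x.resolution_mono (le_max_right α β))
  have h2 := x.add_of_disjoint (A := ⟨Set.Iio α, measurableSet_Iio⟩)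
    (B := ⟨Set.Ico α (max α β), measurableSet_Ico⟩) (C := ⟨Set.Iio (max α β), measurableSet_Iio⟩)
    (Set.disjoint_left.2 fun s hs hs' => hs.not_ge hs'.1)
    (Set.Iio_union_Ico_eq_Iio (le_max_left α β)).symm
  change of (x.resolution α) + _ = of (x.resolution (max α β)) at h2
  rw [hα, h1, of_zero, zero_add] at h2
  exact ⟨α, max α β, le_max_left _ _, le_antisymm (le_one' _)
    (of_injective h2 ▸ x.mono Set.Ico_subset_Icc_self)⟩

theorem isLUB_resolution (s : ℝ) :
    IsLUB (Set.range fun n : ℕ => x.resolution (s - 1 / (n + 1))) (x.resolution s) := by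
  refine x.isLUB_of_iUnion (A := fun n : ℕ => ⟨Set.Iio (s - 1 / ((n : ℝ) + 1)), measurableSet_Iio⟩)
    (fun n => Set.Iio_subset_Iio ?_) ?_
  · have := one_div_le_one_div_of_le (by positivity : (0 : ℝ) < n + 1)
      (by push_cast; linarith : (n : ℝ) + 1 ≤ ((n + 1 : ℕ) : ℝ) + 1)
    linarith
  · ext t
    simp only [Set.mem_iUnion, Set.mem_Iio]
    constructor
    · intro h
      obtain ⟨n, hn⟩ := exists_nat_one_div_lt (sub_pos.2 h)
      exact ⟨n, by linarith⟩
    · rintro ⟨n, hn⟩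
      have : (0 : ℝ) < 1 / (n + 1) := by positivity
      linarith

end Basic

end Observable

/-! ### From point measures to observables -/

section Extension

variable {E : Type*} [EffectAlgebra E] [SigmaMVEffectAlgebra E]

/-- `a` has the value `μ φ A` at almost all points `φ`, in the sense of category. -/
def Represents (μ : Point E → Measure ℝ) (A : Set ℝ) (a : E) : Prop :=
  ∀ᶠ φ in residual (Point E), (μ φ).real A = φ.1 a

variable {μ : Point E → Measure ℝ}

theorem Represents.eq {A : Set ℝ} {a b : E} (ha : Represents μ A a) (hb : Represents μ A b) :
    a = b :=
  eq_of_eventually_point (by filter_upwards [ha, hb] with φ h1 h2; rw [← h1, h2])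

/-- The measure of the union is at most `1`, so `φ a + φ b ≤ 1` generically; this gives `a ≤ bᶜ`,
which is definedness of `a + b`. -/
theorem Represents.exists_add [∀ φ, IsProbabilityMeasure (μ φ)] {A B : Set ℝ} {a b : E}
    (ha : Represents μ A a) (hb : Represents μ B b) (hB : MeasurableSet B) (h : Disjoint A B) :
    ∃ c, of a + of b = of c ∧ Represents μ (A ∪ B) c := by
  have hle : a ≤ bᶜ := le_of_eventually_point (by
    filter_upwards [ha, hb] with φ h1 h2
    rw [φ.2.map_compl, ← h1, ← h2]
    linarith [measureReal_union (μ := μ φ) h hB, measureReal_le_one (μ := μ φ) (s := A ∪ B)])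
  obtain ⟨c, hc⟩ := le_compl_iff.1 hle
  refine ⟨c, hc, ?_⟩
  filter_upwards [ha, hb] with φ h1 h2
  rw [measureReal_union h hB, h1, h2, φ.2.map_add hc]

theorem Represents.iUnion [∀ φ, IsProbabilityMeasure (μ φ)] {A : ℕ → Set ℝ} {a : ℕ → E} {s : E}
    (ha : ∀ n, Represents μ (A n) (a n)) (hA : Monotone A) (hs : IsLUB (Set.range a) s) :
    Represents μ (⋃ n, A n) s := by
  filter_upwards [eventually_countable_forall.2 ha, eventually_isLUB hs] with φ h1 h2
  have h3 : Tendsto (fun n => (μ φ).real (A n)) atTop (𝓝 ((μ φ).real (⋃ n, A n))) :=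
    (ENNReal.tendsto_toReal (measure_ne_top _ _)).comp (tendsto_measure_iUnion_atTop hA)
  have h4 : Monotone fun n => (μ φ).real (A n) := fun n m h => measureReal_mono (hA h)
  simp only [h1] at h3 h4
  exact tendsto_nhds_unique h3 (tendsto_atTop_isLUB h4 h2)

theorem exists_represents [∀ φ, IsProbabilityMeasure (μ φ)]
    (hμ : ∀ t, ∃ a, Represents μ (Set.Iio t) a) {A : Set ℝ} (hA : MeasurableSet A) :
    ∃ a, Represents μ A a := by
  induction A, hA using MeasurableSpace.induction_on_inter
    ((BorelSpace.measurable_eq (α := ℝ)).trans (borel_eq_generateFrom_Iio ℝ))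
    isPiSystem_Iio with
  | empty => exact ⟨0, .of_forall fun φ => by rw [measureReal_empty, φ.2.map_zero]⟩
  | basic A hA =>
    obtain ⟨t, rfl⟩ := hA
    exact hμ t
  | compl A hA ih =>
    obtain ⟨a, ha⟩ := ih
    refine ⟨aᶜ, ?_⟩
    filter_upwards [ha] with φ h
    rw [probReal_compl_eq_one_sub hA, h, φ.2.map_compl]
  | iUnion f hd hf ih =>
    have hacc : ∀ n, ∃ a, Represents μ (Set.accumulate f n) a := by
      intro n
      induction n with
      | zero => rw [Set.accumulate_zero_nat]; exact ih 0
      | succ n ihn =>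
        obtain ⟨a, ha⟩ := ihn
        obtain ⟨b, hb⟩ := ih (n + 1)
        rw [Set.accumulate_succ]
        obtain ⟨c, -, hc⟩ := ha.exists_add hb (hf _) (Set.disjoint_accumulate hd n.lt_succ_self)
        exact ⟨c, hc⟩
    choose a ha using hacc
    rw [← Set.iUnion_accumulate]
    exact ⟨_, .iUnion ha Set.monotone_accumulate (SigmaMVEffectAlgebra.isLUB_countableSup a)⟩

theorem exists_observable_of_measure [∀ φ, IsProbabilityMeasure (μ φ)] {B : ℝ → E}
    (hμ : ∀ t, Represents μ (Set.Iio t) (B t)) :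
    ∃ z : Observable E, ∀ t, B t = z.resolution t := by
  have hex : ∀ A : BorelSet, ∃ a, Represents μ A.1 a := fun A =>
    exists_represents (fun t => ⟨_, hμ t⟩) A.2
  choose f hf using hex
  refine ⟨⟨f, ?_, fun A C hAC => ?_, fun A hA => ?_⟩, fun t => (hμ t).eq (hf ⟨_, measurableSet_Iio⟩)⟩
  · refine (hf _).eq (.of_forall fun φ => ?_)
    rw [probReal_univ, φ.2.map_one]
  · obtain ⟨c, hc, hcr⟩ := (hf A).exists_add (hf C) C.2 hAC
    rw [← of_add_of, hc]
    exact congrArg of (hcr.eq (hf ⟨A.1 ∪ C.1, A.2.union C.2⟩))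
  · have hlub := SigmaMVEffectAlgebra.isLUB_countableSup fun i => f (A i)
    have := Represents.iUnion (fun i => hf (A i))
      (monotone_nat_of_le_succ hA) hlub
    rwa [(hf ⟨⋃ i, (A i).1, _⟩).eq this]

/-- Every spectral resolution with bounded support comes from an observable. -/
theorem IsSpectralResolution.exists_observable {B : ℝ → E} (hB : IsSpectralResolution B)
    {α β : ℝ} (hα : ∀ t ≤ α, B t = 0) (hβ : ∀ t > β, B t = 1) :
    ∃ z : Observable E, ∀ t, B t = z.resolution t := by
  have hmono : Monotone B := fun t s h => h.eq_or_lt.elim (fun h => h ▸ le_rfl) (hB.mono t s)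
  have hF : ∀ φ : Point E, Monotone fun t => φ.1 (B t) := fun φ t s h => φ.2.mono (hmono h)
  have hcoe : ∀ φ : Point E, ⇑(hF φ).stieltjesFunction =
      Function.rightLim fun t => φ.1 (B t) := fun φ => funext (hF φ).stieltjesFunction_eq
  have hbot : ∀ φ : Point E, Tendsto (hF φ).stieltjesFunction atBot (𝓝 0) := fun φ => by
    rw [hcoe]
    refine tendsto_const_nhds.congr' ?_
    filter_upwards [eventually_lt_atBot α] with t ht
    refine le_antisymm ((φ.2.nonneg _).trans ((hF φ).le_rightLim le_rfl)) ?_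
    refine ((hF φ).rightLim_le ht).trans ?_
    rw [hα α le_rfl, φ.2.map_zero]
  have htop : ∀ φ : Point E, Tendsto (hF φ).stieltjesFunction atTop (𝓝 1) := fun φ => by
    rw [hcoe]
    refine tendsto_const_nhds.congr' ?_
    filter_upwards [eventually_gt_atTop β] with t ht
    refine le_antisymm ?_ (((hF φ).rightLim_le (lt_add_one t)).trans (φ.2.le_one _))
    refine le_trans ?_ ((hF φ).le_rightLim (le_refl t))
    rw [hβ t ht, φ.2.map_one]
  have hprob : ∀ φ : Point E, IsProbabilityMeasure (hF φ).stieltjesFunction.measure := fun φ =>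
    (hF φ).stieltjesFunction.isProbabilityMeasure (hbot φ) (htop φ)
  refine exists_observable_of_measure (μ := fun φ => (hF φ).stieltjesFunction.measure)
    fun t => ?_
  have hlub : IsLUB (Set.range fun n : ℕ => B (t - 1 / (n + 1))) (B t) := by
    refine ⟨?_, fun u hu => (hB.left_cont t).2 ?_⟩
    · rintro _ ⟨n, rfl⟩
      exact hmono (sub_le_self t (by positivity))
    · rintro _ ⟨s, hs, rfl⟩
      obtain ⟨n, hn⟩ := exists_nat_one_div_lt (sub_pos.2 (show s < t from hs))
      exact (hmono (by linarith)).trans (hu ⟨n, rfl⟩)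
  filter_upwards [eventually_isLUB hlub] with φ hφ
  have hleft : Function.leftLim (fun t => φ.1 (B t)) t = φ.1 (B t) := by
    refine le_antisymm ((hF φ).leftLim_le le_rfl) (hφ.2 ?_)
    rintro _ ⟨n, rfl⟩
    exact (hF φ).le_leftLim (sub_lt_self t (by positivity))
  -- The Stieltjes function is the right limit of `t ↦ φ (B t)`. The mass of the open ray is its
  -- left limit, which is also the left limit of the original function and so, for generic `φ`, its
  -- value at `t`.
  rw [measureReal_def, StieltjesFunction.measure_Iio _ (hbot φ), hcoe,
    leftLim_rightLim ((hF φ).tendsto_leftLim t), hleft, sub_zero,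
    ENNReal.toReal_ofReal (φ.2.nonneg _)]

end Extension

/-! ### The resolution of the sum -/

namespace Observable

variable {E : Type*} [EffectAlgebra E] [SigmaMVEffectAlgebra E] (x y : Observable E)

theorem inf_le_sumResolution (r : ℚ) (t : ℝ) :
    x.resolution r ⊓ y.resolution (t - r) ≤ x.sumResolution y t :=
  (SigmaMVEffectAlgebra.isLUB_countableSup _).1 ⟨r, rfl⟩

theorem sumResolution_le {t : ℝ} {u : E}
    (h : ∀ r : ℚ, x.resolution r ⊓ y.resolution (t - r) ≤ u) : x.sumResolution y t ≤ u :=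
  (SigmaMVEffectAlgebra.isLUB_countableSup _).2 (by rintro _ ⟨r, rfl⟩; exact h r)

/-- Meeting with `a` commutes with the supremum defining `y.resolution s`, because it does so for
real numbers at generic points. This reduces later arguments to strictly smaller parameters. -/
theorem inf_resolution_le {a u : E} {s : ℝ} (h : ∀ t < s, a ⊓ y.resolution t ≤ u) :
    a ⊓ y.resolution s ≤ u := by
  refine le_of_eventually_point ?_
  filter_upwards [eventually_isLUB (y.isLUB_resolution s)] with φ hφ
  rw [φ.2.map_inf]
  by_contra! hlt
  obtain ⟨h1, h2⟩ := lt_min_iff.1 hlt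
  obtain ⟨_, ⟨n, rfl⟩, h3, -⟩ := hφ.exists_between h2
  have h4 := φ.2.mono (h (s - 1 / (n + 1)) (sub_lt_self s (by positivity)))
  rw [φ.2.map_inf] at h4
  exact (lt_min h1 h3).not_ge h4

theorem sumResolution_mono : Monotone (x.sumResolution y) := fun t s h =>
  x.sumResolution_le y fun r => (inf_le_inf_left _ (y.resolution_mono (by linarith))).trans
    (x.inf_le_sumResolution y r s)

theorem sumResolution_le_swap (t : ℝ) : x.sumResolution y t ≤ y.sumResolution x t := by
  refine x.sumResolution_le y fun r => y.inf_resolution_le fun s hs => ?_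
  -- The index `t - r` may be irrational; left continuity leaves room for a rational `q` between `s`
  -- and `t - r`.
  obtain ⟨q, hsq, hqt⟩ := exists_rat_btwn hs
  rw [inf_comm]
  exact (inf_le_inf (y.resolution_mono hsq.le) (x.resolution_mono (by linarith))).trans
    (y.inf_le_sumResolution x q t)

theorem sumResolution_comm (t : ℝ) : x.sumResolution y t = y.sumResolution x t :=
  le_antisymm (x.sumResolution_le_swap y t) (y.sumResolution_le_swap x t)

theorem isLUB_sumResolution (s : ℝ) :
    IsLUB (x.sumResolution y '' Set.Iio s) (x.sumResolution y s) := by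
  refine ⟨?_, fun u hu => x.sumResolution_le y fun r => y.inf_resolution_le fun t ht => ?_⟩
  · rintro _ ⟨t, ht, rfl⟩
    exact x.sumResolution_mono y (le_of_lt ht)
  · have h1 := x.inf_le_sumResolution y r (t + r)
    rw [add_sub_cancel_right] at h1
    exact h1.trans (hu ⟨t + r, by simpa using (by linarith : t + r < s), rfl⟩)

variable {x y}

theorem IsBounded.exists_sumResolution (hx : x.IsBounded) (hy : y.IsBounded) :
    ∃ α β : ℝ, (∀ t ≤ α, x.sumResolution y t = 0) ∧ ∀ t > β, x.sumResolution y t = 1 := by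
  obtain ⟨α, β, hα, hβ⟩ := hx.exists_resolution
  obtain ⟨α', β', hα', hβ'⟩ := hy.exists_resolution
  refine ⟨α + α', β + β', fun t ht => le_zero_iff'.1 (x.sumResolution_le y fun r => ?_),
    fun t ht => le_antisymm (le_one' _) ?_⟩
  · rcases le_total (r : ℝ) α with h | h
    · exact inf_le_left.trans (hα _ h).le
    · exact inf_le_right.trans (hα' _ (by linarith)).le
  · obtain ⟨r, h1, h2⟩ := exists_rat_btwn (show β < t - β' by linarith)
    have := x.inf_le_sumResolution y r t
    rwa [hβ _ h1, hβ' _ (by linarith), inf_idem] at this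

theorem IsBounded.isSpectralResolution (hx : x.IsBounded) (hy : y.IsBounded) :
    IsSpectralResolution (x.sumResolution y) := by
  obtain ⟨α, β, hα, hβ⟩ := hx.exists_sumResolution hy
  refine ⟨fun t s h => x.sumResolution_mono y h.le, ?_, ?_, x.isLUB_sumResolution y⟩
  · exact ⟨fun _ _ => zero_le' _, fun u hu => hα α le_rfl ▸ hu ⟨α, rfl⟩⟩
  · exact ⟨fun a _ => le_one' a, fun u hu => hβ (β + 1) (lt_add_one β) ▸ hu ⟨β + 1, rfl⟩⟩

end Observable

end Observable

theorem theorem3p3 {E : Type*} [EffectAlgebra E] [SigmaMVEffectAlgebra E]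
    (x y : Observable E) (hx : x.IsBounded) (hy : y.IsBounded) :
    IsSpectralResolution (x.sumResolution y) ∧
    (∃! z : Observable E, z.IsBounded ∧ ∀ t : ℝ, x.sumResolution y t = z.resolution t) ∧
    (∀ t : ℝ, x.sumResolution y t = y.sumResolution x t) := by
  have hB := hx.isSpectralResolution hy
  obtain ⟨α, β, hα, hβ⟩ := hx.exists_sumResolution hy
  obtain ⟨z, hz⟩ := hB.exists_observable hα hβ
  refine ⟨hB, ⟨z, ⟨?_, hz⟩, fun w hw => ?_⟩, x.sumResolution_comm y⟩
  · exact Observable.isBounded_of_resolution ((hz α).symm.trans (hα α le_rfl))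
      ((hz (β + 1)).symm.trans (hβ _ (lt_add_one β)))
  · exact Observable.eq_of_resolution_eq fun t => (hw.2 t).symm.trans (hz t)
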